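/- Let $d \ge 0$ and let $A \in \mathbb{Q}^{d\times d}$. For a set $S$ of complex $d\times d$ matrices let $\overline{S} \subseteq \mathbb{C}^{d\times d}$ be its Zariski closure, i.e. the set of common zeros of all complex polynomials in the $d^2$ matrix entries that vanish on $S$; for an invertible matrix $B$ let $\langle B\rangle = \{B^k : k\in\mathbb{Z}\}$. Then there is an invertible matrix $B$, all of whose entries are algebraic numbers, such that $$\overline{\langle B\rangle} \;=\; \overline{\langle e^{A}\rangle} \;=\; \overline{\{e^{At} : t\in\mathbb{R}\}} .$$ More precisely, $A$ can be written as $A = P^{-1}(D+N)P$ with $P\in \mathrm{GL}_d(\mathbb{C})$, $D=\mathrm{diag}(a_1,\dots,a_d)$, $N$ nilpotent and $DN=ND$ (for instance by the Jordan normal form); and for every such representation there are nonzero rational numbers $\lambda_1,\dots,\lambda_d$ with $$n_1a_1+\dots+n_da_d=0 \iff \lambda_1^{n_1}\cdots\lambda_d^{n_d}=1 \qquad\text{for all } n_1,\dots,n_d\in\mathbb{Z},$$ such that, with $D'=\mathrm{diag}(\lambda_1,\dots,\lambda_d)$, the matrix $B = P^{-1}(D'e^{N})P$ is invertible, has algebraic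 entries, and satisfies the displayed equalities of closures. -/

import Mathlib

open Matrix

noncomputable section

/-- The point of the affine space `ℂ^(d²)` whose coordinates are the entries of a matrix. -/
def entryPoint {d : ℕ} (M : Matrix (Fin d) (Fin d) ℂ) : Fin d × Fin d → ℂ :=
  fun ij => M ij.1 ij.2

/-- The (complex) Zariski closure, in the affine space of `d × d` complex matrices, of a set `S`:
the common zeros `V(I(S))` of all complex polynomials in the `d²` entries that vanish on `S`. -/
def matrixZariskiClosure {d : ℕ} (S : Set (Matrix (Fin d) (Fin d) ℂ)) :
    Set (Matrix (Fin d) (Fin d) ℂ) :=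
  entryPoint ⁻¹'
    MvPolynomial.zeroLocus ℂ (MvPolynomial.vanishingIdeal ℂ (entryPoint '' S))

/-- The cyclic group `⟨B⟩` generated by an invertible matrix, as a set of matrices. -/
def cyclicGroupSet {d : ℕ} (B : GL (Fin d) ℂ) : Set (Matrix (Fin d) (Fin d) ℂ) :=
  (fun g : GL (Fin d) ℂ => (g : Matrix (Fin d) (Fin d) ℂ)) '' (Subgroup.zpowers B : Set _)

/-- A rational matrix seen as a complex matrix. -/
def toComplex {d : ℕ} (A : Matrix (Fin d) (Fin d) ℚ) : Matrix (Fin d) (Fin d) ℂ :=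
  A.map (algebraMap ℚ ℂ)

/-- The matrix exponential `e^M`, as an invertible matrix. -/
def expGL {d : ℕ} (M : Matrix (Fin d) (Fin d) ℂ) : GL (Fin d) ℂ :=
  (Matrix.isUnit_exp M).unit

/-- The one-parameter group `{e^(Mt) : t ∈ ℝ}`. -/
def flowSet {d : ℕ} (M : Matrix (Fin d) (Fin d) ℂ) : Set (Matrix (Fin d) (Fin d) ℂ) :=
  Set.range fun t : ℝ => NormedSpace.exp ((t : ℂ) • M)

/-- All entries of the matrix are algebraic numbers. -/
def IsAlgebraicMatrix {d : ℕ} (M : Matrix (Fin d) (Fin d) ℂ) : Prop :=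
  ∀ i j, IsAlgebraic ℚ (M i j)

/-- `A = P⁻¹ (D + N) P` with `D = diag(a₁, …, a_d)` and `N` nilpotent, `D` and `N` commuting.
Every Jordan normal form of `A` gives such data; the `aᵢ` are the eigenvalues of `A`. -/
structure IsDiagNilpotentForm {d : ℕ} (A : Matrix (Fin d) (Fin d) ℂ) (P : GL (Fin d) ℂ)
    (a : Fin d → ℂ) (N : Matrix (Fin d) (Fin d) ℂ) : Prop where
  nilpotent : IsNilpotent N
  commute : Commute (Matrix.diagonal a) N
  eq_conj : A = ((P⁻¹ : GL (Fin d) ℂ) : Matrix (Fin d) (Fin d) ℂ) * (Matrix.diagonal a + N) *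
    (P : Matrix (Fin d) (Fin d) ℂ)

/-- The nonzero rationals `lam` satisfy exactly the multiplicative relations that correspond to the
additive relations (with integer coefficients) of the complex numbers `a`. -/
def MatchesRelations {d : ℕ} (a : Fin d → ℂ) (lam : Fin d → ℚ) : Prop :=
  (∀ i, lam i ≠ 0) ∧
    ∀ n : Fin d → ℤ, ∑ i, (n i : ℂ) * a i = 0 ↔ ∏ i, lam i ^ n i = 1

/-- The matrix `P⁻¹ (D' e^N) P` with `D' = diag(lam₁, …, lam_d)`. -/
def discretisation {d : ℕ} (P : GL (Fin d) ℂ) (lam : Fin d → ℚ)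
    (N : Matrix (Fin d) (Fin d) ℂ) : Matrix (Fin d) (Fin d) ℂ :=
  ((P⁻¹ : GL (Fin d) ℂ) : Matrix (Fin d) (Fin d) ℂ) *
    (Matrix.diagonal (fun i => (lam i : ℂ)) * NormedSpace.exp N) *
    (P : Matrix (Fin d) (Fin d) ℂ)

end

/-! After conjugation by `P`, all three sets consist of matrices `P⁻¹ diag(x) e^(tN) P`: with `t = k
∈ ℤ` and `xᵢ = λᵢ^k`, with `t = k ∈ ℤ` and `xᵢ = e^(k aᵢ)`, or with `t ∈ ℝ` and `xᵢ = e^(t aᵢ)`. As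
`N` is nilpotent, a polynomial in the entries becomes a finite sum of terms `q_m(t) x^m`, where
`x^m` is the `t`-th power of `∏ λᵢ^mᵢ`, respectively `e^(t w_m)` with `w_m = ∑ mᵢ aᵢ`. Such an
exponential polynomial vanishes at all natural `t` exactly when, for each base, the coefficients
`q_m` with that base sum to zero. So the vanishing ideal depends only on which monomials share a
base.

The three resulting partitions agree. Equality of the `∏ λᵢ^mᵢ` means equality of the `w_m` by the
choice of `λ`: take coordinates of the `aᵢ` in a basis of their ℤ-span as exponents of distinct
primes. Equality of the `e^(w_m)` means the same because the `w_m` are algebraic and no nonzero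
algebraic number has exponential 1, that is, because `π` is transcendental.

For the algebraic entries, uniqueness of the Jordan-Chevalley decomposition makes `P⁻¹ D P` and `P⁻¹
N P` rational, whatever `P` is; `P⁻¹ D' P` is then a polynomial in the former with algebraic
coefficients. -/

section ExpOfAlgebraic

/-! ### Transcendence of `π`, after Lindemann. -/

open Polynomial

theorem Multiset.powerset_map' {α β : Type*} (f : α → β) (s : Multiset α) :
    (s.map f).powerset = s.powerset.map (Multiset.map f) := by
  induction s using Multiset.induction_on with
  | empty => simp
  | cons a s ih => simp [Multiset.powerset_cons, ih, Multiset.map_map]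

theorem Multiset.prod_map_one_add' {α R : Type*} [CommSemiring R] (f : α → R) (s : Multiset α) :
    (s.map fun t => 1 + f t).prod = (s.powerset.map fun u => (u.map f).prod).sum := by
  induction s using Multiset.induction_on with
  | empty => simp
  | cons a s ih =>
    simp [Multiset.powerset_cons, ih, Multiset.map_map, add_mul,
      Multiset.sum_map_mul_left]

variable {E : Type*} [Field E] [Algebra ℚ E]

theorem map_algEquiv_aroots (σ : E ≃ₐ[ℚ] E) (q : ℚ[X]) :
    (q.aroots E).map σ = q.aroots E := by
  classical
  ext x
  obtain ⟨y, rfl⟩ := σ.surjective x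
  rw [Multiset.count_map_eq_count' _ _ σ.injective]
  simp only [aroots, count_roots]
  have e : (q.map (algebraMap ℚ E)).map (σ : E →+* E) = q.map (algebraMap ℚ E) := by
    rw [Polynomial.map_map]
    congr 1
    exact RingHom.ext_rat _ _
  conv_rhs => rw [← e]
  exact (Polynomial.eq_rootMultiplicity_map (f := (σ : E →+* E)) σ.injective y)

theorem exists_rat_of_invariant [IsGalois ℚ E] {x : E} (h : ∀ σ : E ≃ₐ[ℚ] E, σ x = x) :
    ∃ r : ℚ, algebraMap ℚ E r = x :=
  (InfiniteGalois.mem_bot_iff_fixed x).2 h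

theorem exists_rat_polynomial_of_invariant [IsGalois ℚ E] {M : Multiset E}
    (h : ∀ σ : E ≃ₐ[ℚ] E, M.map σ = M) :
    ∃ g : ℚ[X], g.map (algebraMap ℚ E) = (M.map fun b => X - C b).prod := by
  suffices (M.map fun b => X - C b).prod ∈ Polynomial.lifts (algebraMap ℚ E) from this
  rw [Polynomial.lifts_iff_coeff_lifts]
  intro n
  refine exists_rat_of_invariant fun σ => ?_
  have e : ((M.map fun b => X - C b).prod).map (σ : E →+* E) = (M.map fun b => X - C b).prod := by
    rw [Polynomial.map_multiset_prod, Multiset.map_map]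
    conv_rhs => rw [← h σ, Multiset.map_map]
    congr 1
    refine Multiset.map_congr rfl fun x _ => by simp
  conv_rhs => rw [← e]
  simp

theorem exists_int_polynomial_of_invariant [IsGalois ℚ E] {M : Multiset E}
    (h : ∀ σ : E ≃ₐ[ℚ] E, M.map σ = M) :
    ∃ f : ℤ[X], f ≠ 0 ∧
      f.map (algebraMap ℤ E) = C (algebraMap ℤ E f.leadingCoeff) * (M.map fun b => X - C b).prod := by
  obtain ⟨g, hg⟩ := exists_rat_polynomial_of_invariant h
  obtain ⟨b, hb, hf⟩ := IsLocalization.integerNormalization_spec (nonZeroDivisors ℤ) g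
  have hb0 : b ≠ 0 := nonZeroDivisors.ne_zero hb
  have key : (IsLocalization.integerNormalization (nonZeroDivisors ℤ) g).map (algebraMap ℤ E) =
      C (algebraMap ℤ E b) * (M.map fun b => X - C b).prod := by
    rw [← hg, IsScalarTower.algebraMap_eq ℤ ℚ E, ← Polynomial.map_map, hf]
    ext n
    simp
  have hm : ((M.map fun b => X - C b).prod).Monic := monic_multiset_prod_of_monic _ _ fun b _ =>
    monic_X_sub_C b
  have inj : Function.Injective (algebraMap ℤ E) := by
    rw [IsScalarTower.algebraMap_eq ℤ ℚ E]
    exact (algebraMap ℚ E).injective.comp Int.cast_injective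
  have hl : (IsLocalization.integerNormalization (nonZeroDivisors ℤ) g).leadingCoeff = b := by
    apply inj
    rw [← leadingCoeff_map_of_injective inj, key, leadingCoeff_mul, hm, leadingCoeff_C, mul_one]
  refine ⟨_, ?_, by rw [hl]; exact key⟩
  intro h0
  rw [h0] at hl
  exact hb0 (by simpa using hl.symm)

/-- If `M` is a Galois-invariant multiset of roots of `f`, a sum of values at `M` of an integer
polynomial becomes an integer after multiplication by a power of the leading coefficient of `f`. -/
theorem exists_int_eq_leadingCoeff_pow_mul_sum [IsGalois ℚ E] {M : Multiset E}
    (h : ∀ σ : E ≃ₐ[ℚ] E, M.map σ = M) {f : ℤ[X]} (hf : ∀ b ∈ M, aeval b f = 0) (g : ℤ[X])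
    {D : ℕ} (hD : g.natDegree ≤ D) :
    ∃ z : ℤ, (z : E) = (f.leadingCoeff : E) ^ D * (M.map fun b => aeval b g).sum := by
  set x : E := (f.leadingCoeff : E) ^ D * (M.map fun b => aeval b g).sum with hx
  have hint : IsIntegral ℤ x := by
    rw [hx, ← Multiset.sum_map_mul_left]
    refine IsIntegral.multiset_sum fun y hy => ?_
    obtain ⟨b, hb, rfl⟩ := Multiset.mem_map.1 hy
    rw [aeval_eq_sum_range, Finset.mul_sum]
    refine IsIntegral.sum _ fun i hi => ?_
    have hi' : i ≤ D := (Finset.mem_range_succ_iff.1 hi).trans hD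
    -- The leading coefficient times a root is integral, and `i ≤ D` leaves enough factors to attach
    -- one to each `b`.
    have e : (f.leadingCoeff : E) ^ D * g.coeff i • b ^ i =
        ((f.leadingCoeff ^ (D - i) * g.coeff i : ℤ) : E) * (f.leadingCoeff • b) ^ i := by
      rw [zsmul_eq_mul, zsmul_eq_mul, mul_pow, ← Nat.sub_add_cancel hi', pow_add]
      push_cast
      simp only [Nat.add_sub_cancel]
      ring
    rw [e]
    refine IsIntegral.mul ?_ ((isIntegral_leadingCoeff_smul f b (hf b hb)).pow i)
    exact isIntegral_algebraMap (R := ℤ) (A := E)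
      (x := (f.leadingCoeff ^ (D - i) * g.coeff i : ℤ))
  obtain ⟨r, hr⟩ : ∃ r : ℚ, algebraMap ℚ E r = x := by
    refine exists_rat_of_invariant fun σ => ?_
    rw [hx, map_mul, map_pow, map_intCast, map_multiset_sum, Multiset.map_map]
    conv_rhs => rw [← h σ, Multiset.map_map]
    congr 3
    funext b
    simp only [Function.comp_apply, aeval_def]
    rw [show σ (eval₂ (algebraMap ℤ E) b g) = (σ : E →+* E) (eval₂ (algebraMap ℤ E) b g) from rfl,
      hom_eval₂, RingHom.ext_int ((σ : E →+* E).comp (algebraMap ℤ E)) (algebraMap ℤ E)]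
    rfl
  rw [← hr] at hint
  have hint' : IsIntegral ℤ r := (isIntegral_algebraMap_iff (algebraMap ℚ E).injective).1 hint
  obtain ⟨z, hz⟩ := IsIntegrallyClosed.isIntegral_iff.1 hint'
  refine ⟨z, ?_⟩
  rw [← hr, ← hz]
  simp

/-- A nontrivial case of the Lindemann-Weierstrass theorem: a positive integer plus the
exponentials of a Galois-invariant multiset of nonzero algebraic numbers is not zero. -/
theorem natCast_add_sum_exp_ne_zero [IsGalois ℚ E] (φ : E →+* ℂ) {M : Multiset E}
    (h : ∀ σ : E ≃ₐ[ℚ] E, M.map σ = M) (h0 : (0 : E) ∉ M) {k : ℕ} (hk : 0 < k) :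
    (k : ℂ) + (M.map fun b => Complex.exp (φ b)).sum ≠ 0 := by
  intro hsum
  obtain ⟨f, hf0, hf⟩ := exists_int_polynomial_of_invariant h
  have hlc : f.leadingCoeff ≠ 0 := leadingCoeff_ne_zero.2 hf0
  have hlcE : (algebraMap ℤ E f.leadingCoeff) ≠ 0 := by
    have : CharZero E := charZero_of_injective_algebraMap (algebraMap ℚ E).injective
    simpa using hlc
  have root : ∀ b ∈ M, aeval b f = 0 := fun b hb => by
    rw [← eval_map_algebraMap, hf, eval_mul, eval_multiset_prod, Multiset.map_map]
    refine mul_eq_zero_of_right _ (Multiset.prod_eq_zero ?_)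
    exact Multiset.mem_map.2 ⟨b, hb, by simp⟩
  have eval0 : f.eval 0 ≠ 0 := by
    intro h1
    have : (f.map (algebraMap ℤ E)).eval 0 = 0 := by
      rw [← map_zero (algebraMap ℤ E), eval_map_apply, h1, map_zero]
    rw [hf, eval_mul, eval_C, mul_eq_zero, or_iff_right hlcE, eval_multiset_prod,
      Multiset.map_map] at this
    obtain ⟨b, hb, hb'⟩ := Multiset.mem_map.1 (Multiset.prod_eq_zero_iff.1 this)
    have : b = 0 := by simpa using hb'
    exact h0 (this ▸ hb)
  obtain ⟨c, hc⟩ := LindemannWeierstrass.exp_polynomial_approx f eval0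
  set a : ℤ := f.leadingCoeff
  set m : ℕ := f.natDegree
  -- Chosen so that `|a| ^ (p * m) * |c| ^ p = C₁ ^ p`, which `(p - 1)!` outgrows.
  set C₁ : ℝ := |c| * (|(a : ℝ)| ^ m) with hC₁
  have hlim : Filter.Tendsto (fun n : ℕ => (M.card : ℝ) * C₁ * (C₁ ^ n / n.factorial))
      Filter.atTop (nhds 0) := by
    simpa using (FloorSemiring.tendsto_pow_div_factorial_atTop C₁).const_mul ((M.card : ℝ) * C₁)
  obtain ⟨n₀, hn₀⟩ := Filter.eventually_atTop.1 (hlim.eventually (gt_mem_nhds one_pos))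
  -- The summands serve in turn the smallness bound, the approximation lemma, `p ∤ a` and `p ∤ k`.
  obtain ⟨p, hp, pp⟩ := Nat.exists_infinite_primes
    (n₀ + (eval 0 f).natAbs + a.natAbs + k + 1)
  obtain ⟨n, hn, gp, hgp, happ⟩ := hc p (by omega) pp
  obtain ⟨z, hz⟩ := exists_int_eq_leadingCoeff_pow_mul_sum h root gp
    (D := p * m) (hgp.trans (Nat.sub_le _ _))
  have hz' : (z : ℂ) = (a : ℂ) ^ (p * m) * (M.map fun b => aeval (φ b) gp).sum := by
    have := congrArg φ hz
    rw [map_mul, map_pow, map_intCast, map_intCast, map_multiset_sum, Multiset.map_map] at this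
    rw [this]
    congr 3
    funext b
    simp only [Function.comp_apply, aeval_def]
    rw [hom_eval₂, RingHom.ext_int (φ.comp (algebraMap ℤ E)) (algebraMap ℤ ℂ)]
  have aroot : ∀ b ∈ M, φ b ∈ f.aroots ℂ := fun b hb => by
    rw [mem_aroots]
    refine ⟨hf0, ?_⟩
    have := congrArg φ (root b hb)
    rw [aeval_def, hom_eval₂, RingHom.ext_int (φ.comp (algebraMap ℤ E)) (algebraMap ℤ ℂ),
      map_zero] at this
    exact this
  -- the integer `w` is nonzero modulo `p`, but small
  set w : ℤ := a ^ (p * m) * n * k + p * z with hw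
  have hw0 : w ≠ 0 := by
    intro hw0
    have hd : (p : ℤ) ∣ a ^ (p * m) * n * k := by
      refine (dvd_add_left (dvd_mul_right (p : ℤ) z)).1 ?_
      rw [← hw, hw0]
      exact dvd_zero _
    have pp' : Prime (p : ℤ) := Nat.prime_iff_prime_int.1 pp
    rcases pp'.dvd_mul.1 hd with hd | hd
    · rcases pp'.dvd_mul.1 hd with hd | hd
      · have := Int.natAbs_dvd_natAbs.2 (pp'.dvd_of_dvd_pow hd)
        have := Nat.le_of_dvd (Int.natAbs_pos.2 hlc) this
        simp at this
        omega
      · exact hn hd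
    · have := Nat.le_of_dvd hk (Int.natCast_dvd_natCast.1 hd)
      omega
  -- The assumed relation replaces `k` by minus the sum of exponentials, so `w` becomes a sum of
  -- approximation errors.
  have hwC : (w : ℂ) = -((a : ℂ) ^ (p * m) *
      (M.map fun b => n • Complex.exp (φ b) - p • aeval (φ b) gp).sum) := by
    have e1 : (M.map fun b => n • Complex.exp (φ b) - p • aeval (φ b) gp).sum =
        n * (M.map fun b => Complex.exp (φ b)).sum - p * (M.map fun b => aeval (φ b) gp).sum := by
      rw [Multiset.sum_map_sub]
      simp only [zsmul_eq_mul, nsmul_eq_mul, Multiset.sum_map_mul_left]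
    rw [e1, hw]
    push_cast
    rw [hz', eq_neg_of_add_eq_zero_right hsum]
    ring
  have hbound : ‖(w : ℂ)‖ ≤ |(a : ℝ)| ^ (p * m) * (M.card * (|c| ^ p / (p - 1).factorial)) := by
    rw [hwC, norm_neg, norm_mul, norm_pow, Complex.norm_intCast]
    refine mul_le_mul_of_nonneg_left ?_ (by positivity)
    refine (norm_multiset_sum_le _).trans ?_
    rw [Multiset.map_map]
    have := Multiset.sum_le_card_nsmul
      (M.map (norm ∘ fun b => n • Complex.exp (φ b) - p • aeval (φ b) gp))
      (|c| ^ p / (p - 1).factorial) ?_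
    · simpa using this
    intro x hx
    obtain ⟨b, hb, rfl⟩ := Multiset.mem_map.1 hx
    refine (happ (aroot b hb)).trans ?_
    rw [← abs_pow]
    gcongr
    exact le_abs_self _
  have hge : (1 : ℝ) ≤ ‖(w : ℂ)‖ := by
    rw [Complex.norm_intCast]
    exact_mod_cast Int.one_le_abs hw0
  have hlt := hn₀ (p - 1) (by omega)
  have e2 : |(a : ℝ)| ^ (p * m) * (M.card * (|c| ^ p / (p - 1).factorial)) =
      (M.card : ℝ) * C₁ * (C₁ ^ (p - 1) / (p - 1).factorial) := by
    obtain ⟨q, rfl⟩ : ∃ q, p = q + 1 := ⟨p - 1, by omega⟩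
    simp only [Nat.add_sub_cancel, hC₁]
    rw [mul_comm (q + 1) m, pow_mul]
    ring
  rw [e2] at hbound
  linarith

theorem exists_isAlgClosed_isGalois_rat : ∃ (E : Type) (_ : Field E) (_ : Algebra ℚ E),
    IsAlgClosed E ∧ IsGalois ℚ E ∧ Nonempty (E →ₐ[ℚ] ℂ) :=
  ⟨AlgebraicClosure ℚ, inferInstance, AlgebraicClosure.instAlgebra ℚ, inferInstance, inferInstance,
    ⟨IsAlgClosed.lift⟩⟩

/-- `π i` is transcendental. -/
theorem not_isAlgebraic_pi_mul_I : ¬ IsAlgebraic ℚ (Real.pi * Complex.I : ℂ) := by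
  intro halg
  set θ : ℂ := Real.pi * Complex.I
  set q := minpoly ℚ θ
  obtain ⟨E, _, _, _, _, ⟨φ⟩⟩ := exists_isAlgClosed_isGalois_rat
  have hq0 : q ≠ 0 := minpoly.ne_zero halg.isIntegral
  classical
  set R : Multiset E := q.aroots E with hR
  -- Expanding `∏ (1 + e^t)` over the conjugates `t` of `πi` gives the exponentials of all subset
  -- sums; the product is 0 because `e^(πi) = -1`.
  set M : Multiset E := R.powerset.map Multiset.sum with hM
  have hinv : ∀ σ : E ≃ₐ[ℚ] E, M.map σ = M := fun σ => by
    conv_rhs => rw [hM, hR, ← map_algEquiv_aroots σ q, Multiset.powerset_map', Multiset.map_map]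
    rw [hM, Multiset.map_map]
    refine Multiset.map_congr rfl fun s _ => ?_
    simp [map_multiset_sum]
  have hinv' : ∀ σ : E ≃ₐ[ℚ] E,
      (M.filter (· ≠ 0)).map σ = M.filter (· ≠ 0) := fun σ => by
    conv_rhs => rw [← hinv σ, Multiset.filter_map]
    congr 1
    refine Multiset.filter_congr fun x _ => by simp
  have hmemθ : θ ∈ R.map φ := by
    have e : R.map φ = q.aroots ℂ := by
      have := roots_map_of_injective_of_card_eq_natDegree (p := q.map (algebraMap ℚ E))
        (f := (φ : E →+* ℂ)) φ.injective
        (by rw [natDegree_map]; exact IsAlgClosed.card_aroots_eq_natDegree)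
      rw [Polynomial.map_map] at this
      rw [RingHom.ext_rat ((φ : E →+* ℂ).comp (algebraMap ℚ E)) (algebraMap ℚ ℂ)] at this
      exact this
    rw [e, mem_aroots]
    exact ⟨hq0, minpoly.aeval ℚ θ⟩
  have hprod : (R.map fun t => 1 + Complex.exp (φ t)).prod = 0 := by
    obtain ⟨t, ht, hφ⟩ := Multiset.mem_map.1 hmemθ
    refine Multiset.prod_eq_zero (Multiset.mem_map.2 ⟨t, ht, ?_⟩)
    rw [hφ, Complex.exp_pi_mul_I]
    ring
  have hsum : (M.map fun b => Complex.exp (φ b)).sum = 0 := by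
    rw [← hprod, Multiset.prod_map_one_add', hM, Multiset.map_map]
    congr 1
    refine Multiset.map_congr rfl fun s _ => ?_
    simp [map_multiset_sum, Complex.exp_multiset_sum, Multiset.map_map]
  -- The empty subset has sum zero; the zero sums together supply the positive integer.
  have hk : 0 < (M.filter (· = 0)).card := by
    refine Multiset.card_pos_iff_exists_mem.2 ⟨0, ?_⟩
    rw [Multiset.mem_filter]
    exact ⟨Multiset.mem_map.2 ⟨0, by simp, by simp⟩, rfl⟩
  refine natCast_add_sum_exp_ne_zero (φ : E →+* ℂ) hinv' (by simp) hk ?_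
  rw [← hsum]
  conv_rhs => rw [← Multiset.filter_add_not (· = 0) M, Multiset.map_add, Multiset.sum_add]
  congr 1
  rw [Multiset.map_congr rfl (g := fun _ => (1 : ℂ))]
  · simp
  · intro x hx
    simp [(Multiset.mem_filter.1 hx).2]

theorem eq_zero_of_isAlgebraic_of_exp_eq_one {x : ℂ} (hx : IsAlgebraic ℚ x)
    (h : Complex.exp x = 1) : x = 0 := by
  obtain ⟨n, hn⟩ := Complex.exp_eq_one_iff.1 h
  rcases eq_or_ne n 0 with rfl | h0
  · simpa using hn
  refine absurd ?_ not_isAlgebraic_pi_mul_I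
  have e : (Real.pi * Complex.I : ℂ) = x * (algebraMap ℚ ℂ (2 * n)⁻¹) := by
    rw [hn]
    have : (n : ℂ) ≠ 0 := by exact_mod_cast h0
    simp
    field_simp
  rw [e]
  exact hx.mul (isAlgebraic_algebraMap _)

end ExpOfAlgebraic

/-! ### Jordan-Chevalley decomposition and algebraicity of `B`. -/

section DiagNilpotent

open Polynomial

variable {d : ℕ}

theorem exists_basis_eigenvectors_of_isSemisimple {K V : Type*} [Field K] [IsAlgClosed K]
    [AddCommGroup V] [Module K V] [FiniteDimensional K V] {s : Module.End K V}
    (hs : s.IsSemisimple) {ι : Type*} (b₀ : Module.Basis ι K V) :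
    ∃ (b : Module.Basis ι K V) (a : ι → K), ∀ i, s (b i) = a i • b i := by
  classical
  have htop : ⨆ μ, s.eigenspace μ = ⊤ :=
    hs.iSup_maxGenEigenspace_eq_top_iff.1 (Module.End.iSup_maxGenEigenspace_eq_top s)
  have hint := DirectSum.isInternal_submodule_of_iSupIndep_of_iSup_eq_top
    s.eigenspaces_iSupIndep htop
  let c := hint.collectedBasis fun μ => Module.Free.chooseBasis K (s.eigenspace μ)
  let e := c.indexEquiv b₀
  refine ⟨c.reindex e, fun i => (e.symm i).1, fun i => ?_⟩
  rw [Module.Basis.reindex_apply]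
  exact Module.End.mem_eigenspace_iff.1 (hint.collectedBasis_mem _ _)

/-- An eigenbasis of the semisimple part suffices; the nilpotent part commutes with it and needs no
normal form. -/
theorem exists_isDiagNilpotentForm (A : Matrix (Fin d) (Fin d) ℂ) :
    ∃ (P : GL (Fin d) ℂ) (a : Fin d → ℂ) (N : Matrix (Fin d) (Fin d) ℂ),
      IsDiagNilpotentForm A P a N := by
  obtain ⟨n, hn, s, hs, hnil, hss, hA⟩ :=
    Module.End.exists_isNilpotent_isSemisimple (f := Matrix.toLin' A)
  have hcomm : Commute s n := Algebra.commute_of_mem_adjoin_singleton_of_commute hn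
    (Algebra.commute_of_mem_adjoin_self hs).symm
  obtain ⟨b, a, hb⟩ := exists_basis_eigenvectors_of_isSemisimple hss (Pi.basisFun ℂ (Fin d))
  set e := Pi.basisFun ℂ (Fin d)
  have hdiag : LinearMap.toMatrix b b s = Matrix.diagonal a := by
    ext i j
    rw [LinearMap.toMatrix_apply, hb, map_smul, Module.Basis.repr_self, Matrix.diagonal_apply]
    by_cases h : i = j
    · subst h; simp
    · simp [h]
  refine ⟨⟨b.toMatrix e, e.toMatrix b, b.toMatrix_mul_toMatrix_flip e,
    e.toMatrix_mul_toMatrix_flip b⟩, a, LinearMap.toMatrix b b n, ?_, ?_, ?_⟩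
  · exact hnil.map (LinearMap.toMatrixAlgEquiv b)
  · rw [← hdiag]
    exact hcomm.map (LinearMap.toMatrixAlgEquiv b)
  · change A = e.toMatrix b * _ * b.toMatrix e
    rw [← hdiag, ← map_add, add_comm s n, ← hA,
      basis_toMatrix_mul_linearMap_toMatrix_mul_basis_toMatrix, LinearMap.toMatrix_eq_toMatrix',
      LinearMap.toMatrix'_toLin']

/-- Jordan-Chevalley decomposition of a matrix over a perfect field. -/
theorem Matrix.exists_isNilpotent_add_squarefree {K : Type*} [Field K] [PerfectField K]
    (A : Matrix (Fin d) (Fin d) K) :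
    ∃ (n s : Matrix (Fin d) (Fin d) K) (p : K[X]), IsNilpotent n ∧ Commute n s ∧ Squarefree p ∧
      aeval s p = 0 ∧ A = n + s := by
  let e : Matrix (Fin d) (Fin d) K ≃ₐ[K] Module.End K (Fin d → K) := Matrix.toLinAlgEquiv'
  obtain ⟨n, hn, s, hs, hnil, hss, hA⟩ := (e A).exists_isNilpotent_isSemisimple
  have hcomm : Commute n s := (Algebra.commute_of_mem_adjoin_singleton_of_commute hn
    (Algebra.commute_of_mem_adjoin_self hs).symm).symm
  refine ⟨e.symm n, e.symm s, minpoly K s, hnil.map e.symm, hcomm.map e.symm,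
    hss.minpoly_squarefree, ?_, ?_⟩
  · rw [aeval_algHom_apply e.symm, minpoly.aeval, map_zero]
  · rw [← map_add, ← hA, e.symm_apply_apply]

/-- Semisimplicity is expressed by a squarefree annihilating polynomial because this form passes
from ℚ to ℂ: over ℚ squarefree means separable. -/
theorem Matrix.isNilpotent_add_squarefree_unique {K : Type*} [Field K] [PerfectField K]
    {n₁ s₁ n₂ s₂ : Matrix (Fin d) (Fin d) K} {p₁ p₂ : K[X]}
    (hn₁ : IsNilpotent n₁) (hc₁ : Commute n₁ s₁) (hp₁ : Squarefree p₁) (hs₁ : aeval s₁ p₁ = 0)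
    (hn₂ : IsNilpotent n₂) (hc₂ : Commute n₂ s₂) (hp₂ : Squarefree p₂) (hs₂ : aeval s₂ p₂ = 0)
    (h : n₁ + s₁ = n₂ + s₂) : n₁ = n₂ ∧ s₁ = s₂ := by
  let e : Matrix (Fin d) (Fin d) K ≃ₐ[K] Module.End K (Fin d → K) := Matrix.toLinAlgEquiv'
  have ss : ∀ {s : Matrix (Fin d) (Fin d) K} {p : K[X]}, Squarefree p → aeval s p = 0 →
      (e s).IsSemisimple := fun {s p} hp hs =>
    Module.End.isSemisimple_of_squarefree_aeval_eq_zero hp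
      (by rw [aeval_algHom_apply e, hs, map_zero])
  have := Module.End.isNilpotent_isSemisimple_unique (hn₁.map e) (ss hp₁ hs₁) (hn₂.map e)
    (ss hp₂ hs₂) (hc₁.map e) (hc₂.map e) (by rw [← map_add, h, map_add])
  exact ⟨e.injective this.1, e.injective this.2⟩

theorem aeval_units_conj {R A : Type*} [CommSemiring R] [Semiring A] [Algebra R A] (u : Aˣ) (x : A)
    (p : R[X]) : aeval (↑u⁻¹ * x * ↑u) p = ↑u⁻¹ * aeval x p * ↑u := by
  simp only [aeval_eq_sum_range, Units.conj_pow', Finset.mul_sum, Finset.sum_mul,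
    mul_smul_comm, smul_mul_assoc]

theorem Matrix.aeval_diagonal {n R A : Type*} [Fintype n] [DecidableEq n] [CommSemiring R]
    [Semiring A] [Algebra R A] (a : n → A) (p : R[X]) :
    aeval (Matrix.diagonal a) p = Matrix.diagonal fun i => aeval (a i) p := by
  have := aeval_algHom_apply (Matrix.diagonalAlgHom R) a p
  rw [aeval_pi_apply] at this
  exact this

theorem toComplex_aeval (M : Matrix (Fin d) (Fin d) ℚ) (p : ℚ[X]) :
    toComplex (aeval M p) = aeval (toComplex M) p :=
  (aeval_algHom_apply (AlgHom.mapMatrix (Algebra.ofId ℚ ℂ)) M p).symm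

theorem isNilpotent_toComplex {M : Matrix (Fin d) (Fin d) ℚ} (h : IsNilpotent M) :
    IsNilpotent (toComplex M) :=
  h.map ((algebraMap ℚ ℂ).mapMatrix)

/-- The decomposition of `A` over ℚ is still one over ℂ, so by uniqueness it is the given one
conjugated by `P`. The rational annihilator of `s` then kills every `a i`. -/
theorem IsDiagNilpotentForm.exists_rat {A : Matrix (Fin d) (Fin d) ℚ} {P : GL (Fin d) ℂ}
    {a : Fin d → ℂ} {N : Matrix (Fin d) (Fin d) ℂ} (h : IsDiagNilpotentForm (toComplex A) P a N) :
    ∃ n s : Matrix (Fin d) (Fin d) ℚ, IsNilpotent n ∧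
      ((P⁻¹ : GL (Fin d) ℂ) : Matrix (Fin d) (Fin d) ℂ) * N * P = toComplex n ∧
      ((P⁻¹ : GL (Fin d) ℂ) : Matrix (Fin d) (Fin d) ℂ) * Matrix.diagonal a * P = toComplex s ∧
      ∀ i, IsAlgebraic ℚ (a i) := by
  classical
  obtain ⟨n, s, p, hn, hc, hp, hs, rfl⟩ := A.exists_isNilpotent_add_squarefree
  have hps : aeval (toComplex s) p = 0 := by
    rw [← toComplex_aeval, hs]; ext; simp [toComplex]
  -- The product runs over the distinct values of `a`, which makes it squarefree.
  have hdiag : aeval (Matrix.diagonal a) (∏ x ∈ Finset.univ.image a, (X - C x)) = 0 := by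
    rw [Matrix.aeval_diagonal, Matrix.diagonal_eq_zero]
    funext i
    rw [map_prod]
    exact Finset.prod_eq_zero (Finset.mem_image_of_mem a (Finset.mem_univ i)) (by simp)
  have hconj := h.eq_conj
  have hsum : toComplex n + toComplex s = toComplex (n + s) := by
    ext; simp [toComplex]
  have key := Matrix.isNilpotent_add_squarefree_unique
    (n₁ := P⁻¹.val * N * P.val) (s₁ := P⁻¹.val * Matrix.diagonal a * P.val)
    (p₁ := ∏ x ∈ Finset.univ.image a, (X - C x)) (p₂ := p.map (algebraMap ℚ ℂ))
    (n₂ := toComplex n) (s₂ := toComplex s) ?_ ?_ ?_ ?_ (isNilpotent_toComplex hn)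
    (hc.map ((algebraMap ℚ ℂ).mapMatrix)) ?_ ?_ ?_
  · refine ⟨n, s, hn, key.1, key.2, fun i => ⟨p, hp.ne_zero, ?_⟩⟩
    have h1 : P⁻¹.val * aeval (Matrix.diagonal a) p * P.val = 0 := by
      rw [← aeval_units_conj, key.2, hps]
    have h2 : aeval (Matrix.diagonal a) p = 0 := by
      rw [Units.mul_left_eq_zero] at h1
      exact (Units.mul_right_eq_zero _).1 h1
    rw [Matrix.aeval_diagonal, Matrix.diagonal_eq_zero] at h2
    exact congrFun h2 i
  · obtain ⟨k, hk⟩ := h.nilpotent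
    exact ⟨k, by rw [Units.conj_pow', hk]; simp⟩
  · have := h.commute.eq
    rw [commute_iff_eq]
    simp only [mul_assoc, Units.mul_inv_cancel_left]
    rw [← mul_assoc N, ← mul_assoc (Matrix.diagonal a), this]
  · exact (separable_prod_X_sub_C_iff'.2 fun x _ y _ h => h).squarefree
  · rw [aeval_units_conj, hdiag]; simp
  · exact ((PerfectField.separable_iff_squarefree.2 hp).map).squarefree
  · rw [aeval_map_algebraMap, hps]
  · rw [hsum, hconj]
    simp only [mul_add, add_mul]
    abel

namespace IsAlgebraicMatrix

variable {M N : Matrix (Fin d) (Fin d) ℂ}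

theorem mul (hM : IsAlgebraicMatrix M) (hN : IsAlgebraicMatrix N) : IsAlgebraicMatrix (M * N) := by
  intro i j
  rw [Matrix.mul_apply, ← mem_algebraicClosure_iff]
  exact sum_mem fun k _ => mul_mem (mem_algebraicClosure_iff.2 (hM i k))
    (mem_algebraicClosure_iff.2 (hN k j))

theorem one : IsAlgebraicMatrix (1 : Matrix (Fin d) (Fin d) ℂ) := fun i j => by
  rw [Matrix.one_apply]
  split_ifs
  exacts [isAlgebraic_one, isAlgebraic_zero]

theorem pow (hM : IsAlgebraicMatrix M) (n : ℕ) : IsAlgebraicMatrix (M ^ n) := by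
  induction n with
  | zero => exact pow_zero M ▸ one
  | succ n ih => exact pow_succ M n ▸ ih.mul hM

theorem smul {c : ℂ} (hc : IsAlgebraic ℚ c) (hM : IsAlgebraicMatrix M) :
    IsAlgebraicMatrix (c • M) := fun i j => by
  rw [Matrix.smul_apply, smul_eq_mul]
  exact hc.mul (hM i j)

theorem sum {ι : Type*} {s : Finset ι} {f : ι → Matrix (Fin d) (Fin d) ℂ}
    (h : ∀ i ∈ s, IsAlgebraicMatrix (f i)) : IsAlgebraicMatrix (∑ i ∈ s, f i) := fun i j => by
  rw [Matrix.sum_apply, ← mem_algebraicClosure_iff]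
  exact sum_mem fun k hk => mem_algebraicClosure_iff.2 (h k hk i j)

theorem of_toComplex (M : Matrix (Fin d) (Fin d) ℚ) : IsAlgebraicMatrix (toComplex M) :=
  fun i j => isAlgebraic_algebraMap (M i j)

end IsAlgebraicMatrix

theorem exp_smul_eq_sum_of_pow_eq_zero {N : Matrix (Fin d) (Fin d) ℂ} {k : ℕ} (h : N ^ k = 0)
    (t : ℂ) :
    NormedSpace.exp (t • N) = ∑ i ∈ Finset.range k, ((i.factorial : ℂ)⁻¹ * t ^ i) • N ^ i := by
  rw [NormedSpace.exp_eq_tsum ℂ]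
  dsimp only
  rw [tsum_eq_sum (s := Finset.range k)]
  · exact Finset.sum_congr rfl fun i _ => by rw [_root_.smul_pow, smul_smul]
  · intro i hi
    rw [_root_.smul_pow, pow_eq_zero_of_le (by simpa using hi) h, smul_zero, smul_zero]

theorem isAlgebraicMatrix_exp_of_isNilpotent {n : Matrix (Fin d) (Fin d) ℚ} (h : IsNilpotent n) :
    IsAlgebraicMatrix (NormedSpace.exp (toComplex n)) := by
  obtain ⟨k, hk⟩ := isNilpotent_toComplex h
  have := exp_smul_eq_sum_of_pow_eq_zero hk 1
  rw [one_smul] at this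
  rw [this]
  refine IsAlgebraicMatrix.sum fun i _ =>
    ((IsAlgebraicMatrix.of_toComplex n).pow i).smul ?_
  rw [one_pow, mul_one]
  simpa using isAlgebraic_algebraMap (R := ℚ) (A := ℂ) (i.factorial : ℚ)⁻¹

theorem exists_polynomial_of_isAlgebraic {a : Fin d → ℂ} (ha : ∀ i, IsAlgebraic ℚ (a i))
    {lam : Fin d → ℚ} (hl : ∀ i j, a i = a j → lam i = lam j) :
    ∃ p : ℂ[X], (∀ k, IsAlgebraic ℚ (p.coeff k)) ∧ ∀ i, p.eval (a i) = lam i := by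
  classical
  let L := algebraicClosure ℚ ℂ
  let α : Fin d → L := fun i => ⟨a i, mem_algebraicClosure_iff.2 (ha i)⟩
  -- By `hl` the chosen index does not matter; the value 0 off the nodes is arbitrary.
  let r : L → L := fun x => if h : ∃ i, α i = x then ((lam h.choose : ℚ) : L) else 0
  let p : L[X] := Lagrange.interpolate (Finset.univ.image α) id r
  have hr : ∀ i, r (α i) = (lam i : L) := fun i => by
    have h : ∃ j, α j = α i := ⟨i, rfl⟩
    have : a h.choose = a i := congrArg (Subtype.val) h.choose_spec
    simp only [r, dif_pos h, hl _ _ this]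
  refine ⟨p.map (algebraMap L ℂ), fun k => ?_, fun i => ?_⟩
  · rw [coeff_map]
    exact mem_algebraicClosure_iff.1 (p.coeff k).2
  · have := Lagrange.eval_interpolate_at_node (s := Finset.univ.image α) (i := α i) (v := id) r
      (Set.injOn_id _) (Finset.mem_image_of_mem α (Finset.mem_univ i))
    rw [show a i = algebraMap L ℂ (α i) from rfl, eval_map_apply]
    change algebraMap L ℂ (eval (α i) p) = _
    rw [show eval (α i) p = r (α i) from this, hr]
    simp

/-- `P` itself may have transcendental entries, so the matrix is rewritten without it, as `p(s) e^n`
with `s`, `n` rational and `p` an interpolation polynomial with algebraic coefficients. -/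
theorem isAlgebraicMatrix_discretisation {A : Matrix (Fin d) (Fin d) ℚ} {P : GL (Fin d) ℂ}
    {a : Fin d → ℂ} {N : Matrix (Fin d) (Fin d) ℂ} (h : IsDiagNilpotentForm (toComplex A) P a N)
    {lam : Fin d → ℚ} (hl : ∀ i j, a i = a j → lam i = lam j) :
    IsAlgebraicMatrix (discretisation P lam N) := by
  obtain ⟨n, s, hn, hN, hs, ha⟩ := h.exists_rat
  obtain ⟨p, hp, hpl⟩ := exists_polynomial_of_isAlgebraic ha hl
  have e1 : ((P⁻¹ : GL (Fin d) ℂ) : Matrix (Fin d) (Fin d) ℂ) *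
      Matrix.diagonal (fun i => (lam i : ℂ)) * P = aeval (toComplex s) p := by
    rw [← hs, aeval_units_conj, Matrix.aeval_diagonal]
    simp only [coe_aeval_eq_eval, hpl]
  have e2 : ((P⁻¹ : GL (Fin d) ℂ) : Matrix (Fin d) (Fin d) ℂ) * NormedSpace.exp N * P =
      NormedSpace.exp (toComplex n) := by
    rw [← hN, Matrix.exp_units_conj']
  have e3 : discretisation P lam N = aeval (toComplex s) p * NormedSpace.exp (toComplex n) := by
    rw [← e1, ← e2, discretisation]
    simp only [mul_assoc, Units.mul_inv_cancel_left]
  rw [e3, aeval_eq_sum_range]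
  exact (IsAlgebraicMatrix.sum fun i _ => ((IsAlgebraicMatrix.of_toComplex s).pow i).smul
    (hp i)).mul (isAlgebraicMatrix_exp_of_isNilpotent hn)

end DiagNilpotent

/-! ### Rationals with prescribed multiplicative relations. -/

section Relations

theorem padicValRat_prod {ι : Type*} (p : ℕ) [Fact p.Prime] (s : Finset ι) (f : ι → ℚ)
    (hf : ∀ i ∈ s, f i ≠ 0) : padicValRat p (∏ i ∈ s, f i) = ∑ i ∈ s, padicValRat p (f i) := by
  classical
  induction s using Finset.induction_on with
  | empty => simp
  | insert i s hi ih =>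
    rw [Finset.prod_insert hi, Finset.sum_insert hi, padicValRat.mul
      (hf i (Finset.mem_insert_self i s))
      (Finset.prod_ne_zero_iff.2 fun j hj => hf j (Finset.mem_insert_of_mem hj)),
      ih fun j hj => hf j (Finset.mem_insert_of_mem hj)]

theorem prod_prime_zpow_eq_one_iff {ι : Type*} [Fintype ι] (p : ι ↪ Nat.Primes) (c : ι → ℤ) :
    ∏ j, ((p j : ℕ) : ℚ) ^ c j = 1 ↔ ∀ j, c j = 0 := by
  classical
  refine ⟨fun h j => ?_, fun h => by simp [h]⟩
  have hp : Fact (p j : ℕ).Prime := ⟨(p j).2⟩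
  have h1 := congrArg (padicValRat (p j)) h
  rw [padicValRat_prod _ _ _ fun i _ => zpow_ne_zero _ (Nat.cast_ne_zero.2 (p i).2.ne_zero),
    padicValRat.one, Finset.sum_eq_single j] at h1
  · rwa [padicValRat.zpow, padicValRat.self (p j).2.one_lt, mul_one] at h1
  · intro i _ hij
    rw [padicValRat.zpow, padicValRat.of_nat, padicValNat_primes (q := p i) (hq := ⟨(p i).2⟩)]
    · simp
    · intro h
      exact hij (p.injective (Subtype.ext h.symm))
  · simp

/-- The ℤ-span of the `a i` is finitely generated and torsion-free, hence free. Sending a basis to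
distinct primes embeds it in the multiplicative group of ℚ, by unique factorisation. -/
theorem exists_matchesRelations {d : ℕ} (a : Fin d → ℂ) : ∃ lam, MatchesRelations a lam := by
  let V : Submodule ℤ ℂ := Submodule.span ℤ (Set.range a)
  have : Module.Finite ℤ V := Module.Finite.span_of_finite ℤ (Set.finite_range a)
  let b := Module.Free.chooseBasis ℤ V
  let v : Fin d → V := fun i => ⟨a i, Submodule.subset_span (Set.mem_range_self i)⟩
  let p : Module.Free.ChooseBasisIndex ℤ V ↪ Nat.Primes :=
    (Fintype.equivFin _).toEmbedding.trans
      ((Fin.valEmbedding).trans (Infinite.natEmbedding Nat.Primes))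
  have hp : ∀ j, ((p j : ℕ) : ℚ) ≠ 0 := fun j => Nat.cast_ne_zero.2 (p j).2.ne_zero
  refine ⟨fun i => ∏ j, ((p j : ℕ) : ℚ) ^ b.repr (v i) j, fun i =>
    Finset.prod_ne_zero_iff.2 fun j _ => zpow_ne_zero _ (hp j), fun n => ?_⟩
  have e1 : ∏ i, (∏ j, ((p j : ℕ) : ℚ) ^ b.repr (v i) j) ^ n i =
      ∏ j, ((p j : ℕ) : ℚ) ^ (b.repr (∑ i, n i • v i) j) := by
    simp_rw [← Finset.prod_zpow, ← _root_.zpow_mul]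
    rw [Finset.prod_comm]
    refine Finset.prod_congr rfl fun j _ => ?_
    rw [map_sum, Finsupp.finsetSum_apply]
    simp only [map_smul, Finsupp.smul_apply, smul_eq_mul]
    induction (Finset.univ : Finset (Fin d)) using Finset.induction_on with
    | empty => simp
    | insert i s hi ih =>
      rw [Finset.prod_insert hi, Finset.sum_insert hi, zpow_add₀ (hp j), ih, mul_comm (n i)]
  rw [e1, prod_prime_zpow_eq_one_iff]
  have e2 : ∑ i, (n i : ℂ) * a i = ((∑ i, n i • v i : V) : ℂ) := by
    simp [v]
  rw [e2, ZeroMemClass.coe_eq_zero, ← b.repr.map_eq_zero_iff, Finsupp.ext_iff]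
  rfl

theorem MatchesRelations.prod_pow_eq_iff {d : ℕ} {a : Fin d → ℂ} {lam : Fin d → ℚ}
    (h : MatchesRelations a lam) (m m' : Fin d →₀ ℕ) :
    ∏ i, (lam i : ℂ) ^ m i = ∏ i, (lam i : ℂ) ^ m' i ↔
      ∑ i, (m i : ℂ) * a i = ∑ i, (m' i : ℂ) * a i := by
  have h1 := h.2 fun i => (m i : ℤ) - m' i
  have h0 : ∏ i, lam i ^ m' i ≠ 0 := Finset.prod_ne_zero_iff.2 fun i _ => pow_ne_zero _ (h.1 i)
  rw [Finset.prod_congr rfl fun i _ => zpow_sub₀ (h.1 i) _ _] at h1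
  simp only [zpow_natCast, Finset.prod_div_distrib, div_eq_one_iff_eq h0] at h1
  push_cast at h1
  simp only [sub_mul, Finset.sum_sub_distrib, sub_eq_zero] at h1
  rw [h1]
  exact_mod_cast Iff.rfl

theorem MatchesRelations.eq_of_eq {d : ℕ} {a : Fin d → ℂ} {lam : Fin d → ℚ}
    (h : MatchesRelations a lam) {i j : Fin d} (hij : a i = a j) : lam i = lam j := by
  have := (h.prod_pow_eq_iff (Finsupp.single i 1) (Finsupp.single j 1)).2
    (by simpa [Finsupp.single_apply] using hij)
  simpa [Finsupp.single_apply] using this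

end Relations

/-! ### Independence of exponential polynomials on ℕ. -/

section ExponentialPolynomials

open Polynomial

/-- The shift operator on sequences. -/
def shiftSeq : Module.End ℂ (ℕ → ℂ) := LinearMap.funLeft ℂ ℂ Nat.succ

/-- On sequences `g(k) r^k`, shift minus `r` acts as `r` times the difference operator on `g`; for
polynomial `g`, enough differences give zero. -/
theorem shiftSeq_sub_pow_apply (r : ℂ) (g : ℕ → ℂ) (n k : ℕ) :
    ((shiftSeq - algebraMap ℂ _ r) ^ n) (fun k => g k * r ^ k) k =
      (fwdDiff 1)^[n] g k * r ^ (k + n) := by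
  induction n generalizing g k with
  | zero => simp
  | succ n ih =>
    have : (shiftSeq - algebraMap ℂ _ r) (fun k => g k * r ^ k) =
        fun k => (r * fwdDiff 1 g k) * r ^ k := by
      funext k
      simp [shiftSeq, LinearMap.funLeft_apply, fwdDiff, pow_succ, Module.algebraMap_end_apply]
      ring
    rw [pow_succ, Module.End.mul_apply, this, ih, Function.iterate_succ_apply,
      show (fun k => r * fwdDiff 1 g k) = r • fwdDiff 1 g from rfl, fwdDiff_iter_const_smul]
    simp only [Pi.smul_apply, smul_eq_mul]
    ring

theorem mem_maxGenEigenspace_shiftSeq (q : ℂ[X]) (r : ℂ) :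
    (fun k : ℕ => q.eval (k : ℂ) * r ^ k) ∈ shiftSeq.maxGenEigenspace r := by
  rw [Module.End.mem_maxGenEigenspace]
  refine ⟨q.natDegree + 1, ?_⟩
  funext k
  have h := shiftSeq_sub_pow_apply r (fun k : ℕ => q.eval (k : ℂ)) (q.natDegree + 1) k
  rw [← Algebra.algebraMap_eq_smul_one, h]
  have h2 := congrFun (fwdDiff_iter_eq_zero_of_degree_lt (Nat.lt_succ_self q.natDegree)) (k : ℂ)
  have h3 : ∀ n, (fwdDiff 1)^[n] (fun k : ℕ => q.eval (k : ℂ)) k =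
      (fwdDiff 1)^[n] (fun x => q.eval x) (k : ℂ) := fun n => by
    rw [fwdDiff_iter_eq_sum_shift, fwdDiff_iter_eq_sum_shift]
    simp
  rw [h3, h2]
  simp

/-- The terms lie in generalized eigenspaces of the shift for distinct eigenvalues, which are
independent. Base 0 is excluded since `0 ^ k` only sees `k = 0`. -/
theorem eq_zero_of_sum_eval_mul_pow_eq_zero {s : Finset ℂ} (h0 : (0 : ℂ) ∉ s) {q : ℂ → ℂ[X]}
    (h : ∀ k : ℕ, ∑ r ∈ s, (q r).eval (k : ℂ) * r ^ k = 0) : ∀ r ∈ s, q r = 0 := by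
  intro r hr
  have hz : (fun k : ℕ => (q r).eval (k : ℂ) * r ^ k) = 0 :=
    (iSupIndep_iff_finsetSum_eq_zero_imp_eq_zero _).1 shiftSeq.independent_maxGenEigenspace s
      _ (fun r _ => mem_maxGenEigenspace_shiftSeq (q r) r) (by funext k; simpa using h k) r hr
  refine Polynomial.eq_zero_of_infinite_isRoot _ ?_
  refine (Set.infinite_range_of_injective (Nat.cast_injective (R := ℂ))).mono ?_
  rintro _ ⟨k, rfl⟩
  have hr0 : r ≠ 0 := fun h => h0 (h ▸ hr)
  exact (mul_eq_zero.1 (congrFun hz k)).resolve_right (pow_ne_zero _ hr0)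

theorem sum_fiber_eq_zero_of_sum_eval_mul_pow_eq_zero {ι : Type*} {T : Finset ι} {q : ι → ℂ[X]}
    {ρ : ι → ℂ} (hρ : ∀ i ∈ T, ρ i ≠ 0)
    (h : ∀ k : ℕ, ∑ i ∈ T, (q i).eval (k : ℂ) * ρ i ^ k = 0) {j : ι} (hj : j ∈ T) :
    ∑ i ∈ T with ρ i = ρ j, q i = 0 := by
  classical
  refine eq_zero_of_sum_eval_mul_pow_eq_zero (s := T.image ρ)
    (q := fun r => ∑ i ∈ T with ρ i = r, q i) ?_ (fun k => ?_) (ρ j) (Finset.mem_image_of_mem ρ hj)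
  · intro h
    obtain ⟨i, hi, h⟩ := Finset.mem_image.1 h
    exact hρ i hi h
  · rw [← h k, ← Finset.sum_fiberwise_of_maps_to (g := ρ) (t := T.image ρ)
      (fun i hi => Finset.mem_image_of_mem ρ hi)]
    refine Finset.sum_congr rfl fun r _ => ?_
    rw [eval_finsetSum, Finset.sum_mul]
    exact Finset.sum_congr rfl fun i hi => by rw [(Finset.mem_filter.1 hi).2]

/-- Converse direction. An arbitrary `Φ` of the base covers negative powers and, with `ρ = w`,
exponentials at real times. -/
theorem sum_eval_mul_eq_zero_of_sum_fiber_eq_zero {ι : Type*} {T : Finset ι} {q : ι → ℂ[X]}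
    {ρ : ι → ℂ} (h : ∀ j ∈ T, ∑ i ∈ T with ρ i = ρ j, q i = 0) (Φ : ℂ → ℂ) (x : ℂ) :
    ∑ i ∈ T, (q i).eval x * Φ (ρ i) = 0 := by
  classical
  rw [← Finset.sum_fiberwise_of_maps_to (g := ρ) (t := T.image ρ)
      (fun i hi => Finset.mem_image_of_mem ρ hi)]
  refine Finset.sum_eq_zero fun r hr => ?_
  obtain ⟨j, hj, rfl⟩ := Finset.mem_image.1 hr
  rw [Finset.sum_congr rfl (g := fun i => (q i).eval x * Φ (ρ j))
    fun i hi => by rw [(Finset.mem_filter.1 hi).2], ← Finset.sum_mul, ← eval_finsetSum, h j hj]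
  simp

end ExponentialPolynomials

/-! ### Comparison of the three Zariski closures. -/

section Closures

variable {d : ℕ}

/-- The matrices `P⁻¹ (diag(x) e^(tN)) P`, among which are the elements of all the groups that the
main theorem compares. -/
noncomputable def torusUnipotent (P : GL (Fin d) ℂ) (N : Matrix (Fin d) (Fin d) ℂ) (x : Fin d → ℂ)
    (t : ℂ) : Matrix (Fin d) (Fin d) ℂ :=
  P⁻¹.val * (Matrix.diagonal x * NormedSpace.exp (t • N)) * P.val

/-- A polynomial in the entries of `P⁻¹ (diag(x) e^(tN)) P` is a polynomial in `x` and `t`. -/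
theorem exists_mvPolynomial_eval_torusUnipotent (P : GL (Fin d) ℂ) {N : Matrix (Fin d) (Fin d) ℂ}
    (hN : IsNilpotent N) (f : MvPolynomial (Fin d × Fin d) ℂ) :
    ∃ F : MvPolynomial (Fin d) (Polynomial ℂ), ∀ x t,
      MvPolynomial.aeval (entryPoint (torusUnipotent P N x t)) f =
        ∑ m ∈ F.support, (F.coeff m).eval t * ∏ i, x i ^ m i := by
  obtain ⟨k, hk⟩ := hN
  let R := MvPolynomial (Fin d) (Polynomial ℂ)
  let ψ : ℂ →+* R := MvPolynomial.C.comp Polynomial.C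
  -- The terminating series of `e^(tN)`, with `t` the variable of the coefficient ring.
  let Q : Matrix (Fin d) (Fin d) R := ∑ i ∈ Finset.range k,
    (MvPolynomial.C (Polynomial.C (i.factorial : ℂ)⁻¹ * Polynomial.X ^ i) : R) • (N ^ i).map ψ
  let G : Matrix (Fin d) (Fin d) R :=
    P⁻¹.val.map ψ * (Matrix.diagonal MvPolynomial.X * Q) * P.val.map ψ
  refine ⟨MvPolynomial.eval₂ ψ (fun ij => G ij.1 ij.2) f, fun x t => ?_⟩
  let φ : R →+* ℂ := MvPolynomial.eval₂Hom (Polynomial.evalRingHom t) x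
  have hC : ∀ p, φ (MvPolynomial.C p) = p.eval t := fun p => MvPolynomial.eval₂Hom_C _ _ p
  have hX : ∀ i, φ (MvPolynomial.X i) = x i := fun i => MvPolynomial.eval₂Hom_X' _ _ i
  have hψ : ∀ c, φ (ψ c) = c := fun c => (hC _).trans Polynomial.eval_C
  have hmap : ∀ M : Matrix (Fin d) (Fin d) ℂ, φ.mapMatrix (M.map ψ) = M := fun M => by
    ext i j; simp [hψ]
  have hQ : φ.mapMatrix Q = NormedSpace.exp (t • N) := by
    rw [exp_smul_eq_sum_of_pow_eq_zero hk, map_sum]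
    refine Finset.sum_congr rfl fun i _ => ?_
    ext a b
    rw [RingHom.mapMatrix_apply, Matrix.map_apply, Matrix.smul_apply, Matrix.smul_apply,
      smul_eq_mul, smul_eq_mul, Matrix.map_apply, map_mul φ, hC, hψ]
    simp
  have hG : φ.mapMatrix G = torusUnipotent P N x t := by
    rw [map_mul, map_mul, map_mul, hmap, hmap, hQ, torusUnipotent]
    congr 3
    ext i j
    by_cases h : i = j
    · subst h; simp [hX]
    · simp [h]
  have h1 : φ (MvPolynomial.eval₂ ψ (fun ij => G ij.1 ij.2) f) =
      MvPolynomial.aeval (entryPoint (torusUnipotent P N x t)) f := by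
    rw [MvPolynomial.hom_eval₂, ← hG, RingHom.ext (f := φ.comp ψ) (g := algebraMap ℂ ℂ) hψ]
    rfl
  rw [← h1]
  exact MvPolynomial.eval₂_eq' _ _ _

theorem matrixZariskiClosure_congr {S T : Set (Matrix (Fin d) (Fin d) ℂ)}
    (h : ∀ f : MvPolynomial (Fin d × Fin d) ℂ, (∀ M ∈ S, MvPolynomial.aeval (entryPoint M) f = 0) ↔
      ∀ M ∈ T, MvPolynomial.aeval (entryPoint M) f = 0) :
    matrixZariskiClosure S = matrixZariskiClosure T := by
  have : MvPolynomial.vanishingIdeal ℂ (entryPoint '' S) =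
      MvPolynomial.vanishingIdeal ℂ (entryPoint '' T) := by
    ext f
    simpa only [MvPolynomial.mem_vanishingIdeal_iff, Set.forall_mem_image] using h f
  rw [matrixZariskiClosure, this, matrixZariskiClosure]

variable {A : Matrix (Fin d) (Fin d) ℚ} {P : GL (Fin d) ℂ} {a : Fin d → ℂ}
  {N : Matrix (Fin d) (Fin d) ℂ}

theorem IsDiagNilpotentForm.exp_smul {A : Matrix (Fin d) (Fin d) ℂ}
    (h : IsDiagNilpotentForm A P a N) (t : ℂ) :
    NormedSpace.exp (t • A) = torusUnipotent P N (fun i => Complex.exp (t * a i)) t := by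
  have e : t • A = P⁻¹.val * (t • Matrix.diagonal a + t • N) * P.val := by
    conv_lhs => rw [h.eq_conj]
    rw [← smul_add, mul_smul_comm, smul_mul_assoc]
  rw [e, Matrix.exp_units_conj', Matrix.exp_add_of_commute _ _
    ((h.commute.smul_left t).smul_right t), ← Matrix.diagonal_smul, Matrix.exp_diagonal,
    torusUnipotent]
  congr 4
  funext i
  rw [Pi.coe_exp]; simp [Complex.exp_eq_exp_ℂ]

/-- Carries commutation with `N` over from `D` to `D'`, since equal `aᵢ` force equal `λᵢ`. -/
theorem Matrix.commute_diagonal_iff {n R : Type*} [Fintype n] [DecidableEq n] [CommRing R]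
    [IsDomain R] {a : n → R} {N : Matrix n n R} :
    Commute (Matrix.diagonal a) N ↔ ∀ i j, N i j ≠ 0 → a i = a j := by
  rw [commute_iff_eq, ← Matrix.ext_iff]
  refine forall₂_congr fun i j => ?_
  rw [Matrix.diagonal_mul, Matrix.mul_diagonal, mul_comm]
  by_cases h : N i j = 0
  · simp [h]
  · simp [h]

theorem cyclicGroupSet_eq_range (B : GL (Fin d) ℂ) :
    cyclicGroupSet B = Set.range fun k : ℤ => (B ^ k).val := by
  ext M
  simp only [cyclicGroupSet, Set.mem_image, SetLike.mem_coe, Subgroup.mem_zpowers_iff,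
    Set.mem_range]
  constructor
  · rintro ⟨_, ⟨k, rfl⟩, rfl⟩; exact ⟨k, rfl⟩
  · rintro ⟨k, rfl⟩; exact ⟨_, ⟨k, rfl⟩, rfl⟩

theorem exp_zsmul_eq_zpow_expGL (M : Matrix (Fin d) (Fin d) ℂ) (k : ℤ) :
    ((expGL M) ^ k).val = NormedSpace.exp ((k : ℂ) • M) := by
  rw [Int.cast_smul_eq_zsmul, Matrix.exp_zsmul, Matrix.coe_units_zpow]
  rfl

theorem IsDiagNilpotentForm.cyclicGroupSet_expGL {A : Matrix (Fin d) (Fin d) ℂ}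
    (h : IsDiagNilpotentForm A P a N) : cyclicGroupSet (expGL A) =
      Set.range fun k : ℤ => torusUnipotent P N (fun i => Complex.exp (k * a i)) k := by
  simp_rw [cyclicGroupSet_eq_range, exp_zsmul_eq_zpow_expGL, h.exp_smul]

theorem IsDiagNilpotentForm.flowSet_eq_range {A : Matrix (Fin d) (Fin d) ℂ}
    (h : IsDiagNilpotentForm A P a N) : flowSet A =
      Set.range fun t : ℝ => torusUnipotent P N (fun i => Complex.exp (t * a i)) t := by
  simp_rw [flowSet, h.exp_smul]

/-- The matrix `P⁻¹ (D' e^N) P` as an invertible matrix. -/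
noncomputable def discretisationGL (P : GL (Fin d) ℂ) {lam : Fin d → ℚ} (hl : ∀ i, lam i ≠ 0)
    (N : Matrix (Fin d) (Fin d) ℂ) : GL (Fin d) ℂ :=
  P⁻¹ * ((Matrix.isUnit_diagonal.2 (Pi.isUnit_iff.2 fun i =>
    (Rat.cast_ne_zero (α := ℂ).2 (hl i)).isUnit)).unit * expGL N) * P

theorem coe_discretisationGL (P : GL (Fin d) ℂ) {lam : Fin d → ℚ} (hl : ∀ i, lam i ≠ 0)
    (N : Matrix (Fin d) (Fin d) ℂ) : (discretisationGL P hl N).val = discretisation P lam N :=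
  rfl

theorem cyclicGroupSet_discretisationGL (P : GL (Fin d) ℂ) {lam : Fin d → ℚ}
    (hl : ∀ i, lam i ≠ 0) (hN : Commute (Matrix.diagonal fun i => (lam i : ℂ)) N) :
    cyclicGroupSet (discretisationGL P hl N) =
      Set.range fun k : ℤ => torusUnipotent P N (fun i => (lam i : ℂ) ^ k) k := by
  rw [cyclicGroupSet_eq_range]
  congr 1
  funext k
  set D := (Matrix.isUnit_diagonal.2 (Pi.isUnit_iff.2 fun i =>
    (Rat.cast_ne_zero (α := ℂ).2 (hl i)).isUnit)).unit with hD
  have hc : Commute D (expGL N) := Units.ext (hN.exp_right).eq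
  have h1 : discretisationGL P hl N ^ k = P⁻¹ * (D ^ k * expGL N ^ k) * P := by
    rw [← hc.mul_zpow]
    have := conj_zpow (i := k) (a := P⁻¹) (b := D * expGL N)
    rw [inv_inv] at this
    exact this
  have h2 : (D ^ k).val = Matrix.diagonal fun i => (lam i : ℂ) ^ k := by
    let u : (Fin d → ℂ)ˣ := (Pi.isUnit_iff.2 fun i =>
      (Rat.cast_ne_zero (α := ℂ).2 (hl i)).isUnit : IsUnit fun i => (lam i : ℂ)).unit
    have e : D = Units.map (Matrix.diagonalRingHom (Fin d) ℂ : (Fin d → ℂ) →* _) u :=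
      Units.ext rfl
    rw [e, ← map_zpow]
    change Matrix.diagonal (u ^ k).val = _
    congr 1
    funext i
    change (Units.map (Pi.evalMonoidHom (fun _ : Fin d => ℂ) i) (u ^ k)).val = _
    rw [map_zpow, Units.val_zpow_eq_zpow_val]
    rfl
  rw [h1]
  simp only [Units.val_mul, exp_zsmul_eq_zpow_expGL, h2, torusUnipotent]

theorem IsDiagNilpotentForm.matrixZariskiClosure_eq (h : IsDiagNilpotentForm (toComplex A) P a N)
    {lam : Fin d → ℚ} (hl : MatchesRelations a lam) :
    matrixZariskiClosure (cyclicGroupSet (discretisationGL P hl.1 N)) =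
        matrixZariskiClosure (cyclicGroupSet (expGL (toComplex A))) ∧
      matrixZariskiClosure (cyclicGroupSet (expGL (toComplex A))) =
        matrixZariskiClosure (flowSet (toComplex A)) := by
  have hN : Commute (Matrix.diagonal fun i => (lam i : ℂ)) N := by
    rw [Matrix.commute_diagonal_iff]
    intro i j hij
    rw [hl.eq_of_eq (Matrix.commute_diagonal_iff.1 h.commute i j hij)]
  obtain ⟨-, -, -, -, -, ha⟩ := h.exists_rat
  let w : (Fin d →₀ ℕ) → ℂ := fun m => ∑ i, (m i : ℂ) * a i
  have hw : ∀ m, IsAlgebraic ℚ (w m) := fun m => by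
    rw [← mem_algebraicClosure_iff]
    exact sum_mem fun i _ => mul_mem (natCast_mem _ _) (mem_algebraicClosure_iff.2 (ha i))
  -- This is where the transcendence of `π` enters.
  have hexp : ∀ m m', Complex.exp (w m) = Complex.exp (w m') ↔ w m = w m' := fun m m' => by
    refine ⟨fun e => ?_, fun e => e ▸ rfl⟩
    refine sub_eq_zero.1 (eq_zero_of_isAlgebraic_of_exp_eq_one ((hw m).sub (hw m')) ?_)
    rw [Complex.exp_sub, e, div_self (Complex.exp_ne_zero _)]
  have hprod : ∀ (t : ℂ) (m : Fin d →₀ ℕ),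
      ∏ i, Complex.exp (t * a i) ^ m i = Complex.exp (t * w m) := fun t m => by
    simp only [w, Finset.mul_sum, Complex.exp_sum, ← Complex.exp_nat_mul]
    exact Finset.prod_congr rfl fun i _ => by ring_nf
  -- vanishing on each of the three sets means that the same sums of coefficients vanish
  have key : ∀ f : MvPolynomial (Fin d × Fin d) ℂ,
      ∃ p : Prop, ((∀ M ∈ cyclicGroupSet (discretisationGL P hl.1 N),
          MvPolynomial.aeval (entryPoint M) f = 0) ↔ p) ∧
        ((∀ M ∈ cyclicGroupSet (expGL (toComplex A)),
          MvPolynomial.aeval (entryPoint M) f = 0) ↔ p) ∧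
        ((∀ M ∈ flowSet (toComplex A), MvPolynomial.aeval (entryPoint M) f = 0) ↔ p) := by
    intro f
    obtain ⟨F, hF⟩ := exists_mvPolynomial_eval_torusUnipotent P h.nilpotent f
    rw [cyclicGroupSet_discretisationGL P hl.1 hN, h.cyclicGroupSet_expGL, h.flowSet_eq_range]
    simp only [Set.forall_mem_range, hF, hprod]
    have toSums : (∀ k : ℤ, ∑ m ∈ F.support, (F.coeff m).eval (k : ℂ) * Complex.exp (k * w m) = 0) →
        ∀ m' ∈ F.support, ∑ m ∈ F.support with w m = w m', F.coeff m = 0 := by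
      intro H m' hm'
      have := sum_fiber_eq_zero_of_sum_eval_mul_pow_eq_zero (T := F.support)
        (q := fun m => F.coeff m) (ρ := fun m => Complex.exp (w m))
        (fun _ _ => Complex.exp_ne_zero _)
        (fun k => by simpa [Complex.exp_nat_mul] using H k) hm'
      simpa only [hexp] using this
    refine ⟨∀ m' ∈ F.support, ∑ m ∈ F.support with w m = w m', F.coeff m = 0,
      ⟨fun H m' hm' => ?_, fun H k => ?_⟩, ⟨toSums, fun H k => ?_⟩, ⟨fun H => ?_, fun H t => ?_⟩⟩
    · have := sum_fiber_eq_zero_of_sum_eval_mul_pow_eq_zero (T := F.support)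
        (q := fun m => F.coeff m) (ρ := fun m => ∏ i, (lam i : ℂ) ^ m i)
        (fun _ _ => Finset.prod_ne_zero_iff.2 fun i _ =>
          pow_ne_zero _ (Rat.cast_ne_zero.2 (hl.1 i)))
        (fun k => by
          have := H k
          simpa only [Int.cast_natCast, zpow_natCast, ← Finset.prod_pow, pow_right_comm] using this)
        hm'
      simpa only [hl.prod_pow_eq_iff] using this
    · have := sum_eval_mul_eq_zero_of_sum_fiber_eq_zero (T := F.support)
        (q := fun m => F.coeff m) (ρ := fun m => ∏ i, (lam i : ℂ) ^ m i)
        (by simpa only [hl.prod_pow_eq_iff] using H) (fun r => r ^ k) k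
      rw [← this]
      refine Finset.sum_congr rfl fun m _ => ?_
      simp only [← Finset.prod_zpow, ← zpow_natCast, ← _root_.zpow_mul, mul_comm]
    · exact sum_eval_mul_eq_zero_of_sum_fiber_eq_zero (T := F.support)
        (q := fun m => F.coeff m) (ρ := w) H (fun r => Complex.exp (k * r)) k
    -- Integer times of the flow already force the sums to vanish.
    · exact toSums fun k => by simpa using H k
    · exact sum_eval_mul_eq_zero_of_sum_fiber_eq_zero (T := F.support)
        (q := fun m => F.coeff m) (ρ := w) H (fun r => Complex.exp (t * r)) t
  constructor
  · refine matrixZariskiClosure_congr fun f => ?_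
    obtain ⟨p, h1, h2, -⟩ := key f
    exact h1.trans h2.symm
  · refine matrixZariskiClosure_congr fun f => ?_
    obtain ⟨p, -, h2, h3⟩ := key f
    exact h2.trans h3.symm

end Closures

theorem mainTheorem8 (d : ℕ) (A : Matrix (Fin d) (Fin d) ℚ) :
    (∃ B : GL (Fin d) ℂ,
      IsAlgebraicMatrix (B : Matrix (Fin d) (Fin d) ℂ) ∧
      matrixZariskiClosure (cyclicGroupSet B) =
        matrixZariskiClosure (cyclicGroupSet (expGL (toComplex A))) ∧
      matrixZariskiClosure (cyclicGroupSet (expGL (toComplex A))) =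
        matrixZariskiClosure (flowSet (toComplex A))) ∧
    (∃ (P : GL (Fin d) ℂ) (a : Fin d → ℂ) (N : Matrix (Fin d) (Fin d) ℂ),
      IsDiagNilpotentForm (toComplex A) P a N) ∧
    ∀ (P : GL (Fin d) ℂ) (a : Fin d → ℂ) (N : Matrix (Fin d) (Fin d) ℂ),
      IsDiagNilpotentForm (toComplex A) P a N →
      ∃ (lam : Fin d → ℚ) (B : GL (Fin d) ℂ),
        MatchesRelations a lam ∧
        (B : Matrix (Fin d) (Fin d) ℂ) = discretisation P lam N ∧
        IsAlgebraicMatrix (B : Matrix (Fin d) (Fin d) ℂ) ∧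
        matrixZariskiClosure (cyclicGroupSet B) =
          matrixZariskiClosure (cyclicGroupSet (expGL (toComplex A))) ∧
        matrixZariskiClosure (cyclicGroupSet (expGL (toComplex A))) =
          matrixZariskiClosure (flowSet (toComplex A)) := by
  have main : ∀ (P : GL (Fin d) ℂ) (a : Fin d → ℂ) (N : Matrix (Fin d) (Fin d) ℂ),
      IsDiagNilpotentForm (toComplex A) P a N →
      ∃ (lam : Fin d → ℚ) (B : GL (Fin d) ℂ),
        MatchesRelations a lam ∧
        (B : Matrix (Fin d) (Fin d) ℂ) = discretisation P lam N ∧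
        IsAlgebraicMatrix (B : Matrix (Fin d) (Fin d) ℂ) ∧
        matrixZariskiClosure (cyclicGroupSet B) =
          matrixZariskiClosure (cyclicGroupSet (expGL (toComplex A))) ∧
        matrixZariskiClosure (cyclicGroupSet (expGL (toComplex A))) =
          matrixZariskiClosure (flowSet (toComplex A)) := by
    intro P a N h
    obtain ⟨lam, hl⟩ := exists_matchesRelations a
    refine ⟨lam, discretisationGL P hl.1 N, hl, coe_discretisationGL P hl.1 N, ?_,
      h.matrixZariskiClosure_eq hl⟩
    rw [coe_discretisationGL]
    exact isAlgebraicMatrix_discretisation h fun i j => hl.eq_of_eq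
  obtain ⟨P, a, N, h⟩ := exists_isDiagNilpotentForm (toComplex A)
  obtain ⟨_, B, -, -, hB⟩ := main P a N h
  exact ⟨⟨B, hB⟩, ⟨P, a, N, h⟩, main⟩
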